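/- Let $G$ be a locally compact second-countable topological group with left Haar measure $dx$, and let $d$ be a left-invariant metric on $G$ inducing its topology. Suppose that $G$ is amenable, that is, the space of bounded left-uniformly continuous functions $\phi\colon G\to\mathbb R$ (those bounded $\phi$ such that for every $\delta>0$ there is an identity neighbourhood $V$ with $|\phi(gv)-\phi(g)|<\delta$ for all $g\in G$, $v\in V$) admits a mean (a positive linear functional of norm one with value $1$ at the constant function $1$) that is invariant under all right translations $\phi\mapsto\phi(\,\cdot\,g)$, $g\in G$. Suppose also that every continuous homomorphism $G\to(\mathbb R,+)$ is trivial. Let $L^1_{d,+,1}(G)$ be the set of all $f\in L^1(G)$ with $f\geqslant 0$, $\int f\,dx=1$ and $\int d(x,1)f(x)\,dx<\infty$. For $f,h\in L^1_{d,+,1}(G)$ let $$\mathsf W(f,h)=\inf_\eta\int_{G\times G} d(x,y)\,d\eta(x,y),$$ the infimum being taken over all Borel probability measures $\eta$ on $G\times G$ with first marginal $f\,dx$ and second marginal $h\,dx$. For $y\in G$ write $R_yf=f(\,\cdot\,y)$. Then for every compact subset $C\subseteq G$ and every $\varepsilon>0$ there is a compactly supported $f\in L^1_{d,+,1}(G)$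 such that $R_yf\in L^1_{d,+,1}(G)$ for all $y\in G$ and $$\mathsf W(R_yf,R_zf)<\varepsilon\qquad\text{for all }y,z\in C.$$ -/

import Mathlib

open MeasureTheory Topology
open scoped ENNReal BoundedContinuousFunction

/-- The space of bounded left-uniformly continuous real functions on a topological group `G`:
bounded `φ` such that for every `ε > 0` there is an identity neighbourhood `V` with
`|φ (g * v) - φ g| < ε` for all `g ∈ G` and `v ∈ V`. It carries the supremum norm. -/
def LUCB (G : Type*) [Group G] [TopologicalSpace G] : Submodule ℝ (G →ᵇ ℝ) where
  carrier := {φ | ∀ ε : ℝ, 0 < ε → ∃ V ∈ 𝓝 (1 : G), ∀ g : G, ∀ v ∈ V, |φ (g * v) - φ g| < ε}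
  zero_mem' := by
    intro ε hε
    exact ⟨Set.univ, Filter.univ_mem, fun g v _ => by simpa using hε⟩
  add_mem' := by
    intro φ ψ hφ hψ ε hε
    obtain ⟨V, hV, h1⟩ := hφ (ε / 2) (half_pos hε)
    obtain ⟨W, hW, h2⟩ := hψ (ε / 2) (half_pos hε)
    refine ⟨V ∩ W, Filter.inter_mem hV hW, fun g v hv => ?_⟩
    have a := abs_lt.1 (h1 g v hv.1)
    have b := abs_lt.1 (h2 g v hv.2)
    simp only [BoundedContinuousFunction.add_apply]
    rw [abs_lt]
    constructor <;> linarith [a.1, a.2, b.1, b.2]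
  smul_mem' := by
    intro c φ hφ ε hε
    have hc : 0 < |c| + 1 := by positivity
    obtain ⟨V, hV, h1⟩ := hφ (ε / (|c| + 1)) (div_pos hε hc)
    refine ⟨V, hV, fun g v hv => ?_⟩
    have h2 := (lt_div_iff₀ hc).1 (h1 g v hv)
    have h3 := abs_nonneg (φ (g * v) - φ g)
    simp only [BoundedContinuousFunction.smul_apply, smul_eq_mul]
    rw [← mul_sub, abs_mul]
    linarith

/-- The constant function `1`, as an element of `LUCB G`. -/
def LUCB.one (G : Type*) [Group G] [TopologicalSpace G] : LUCB G :=
  ⟨1, fun ε hε => ⟨Set.univ, Filter.univ_mem, fun g v _ => by simpa using hε⟩⟩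

/-- Right translation on `LUCB G`: `(ρ(h) φ)(x) = φ (x * h)`. -/
def LUCB.rho {G : Type*} [Group G] [TopologicalSpace G] [IsTopologicalGroup G] (h : G)
    (φ : LUCB G) : LUCB G :=
  ⟨(φ : G →ᵇ ℝ).compContinuous (ContinuousMap.mulRight h), by
    intro ε hε
    obtain ⟨V, hV, hφ⟩ := φ.2 ε hε
    have hc : Continuous (fun x : G => h⁻¹ * x * h) := by fun_prop
    refine ⟨(fun x : G => h⁻¹ * x * h) ⁻¹' V, hc.continuousAt.preimage_mem_nhds (by simpa), ?_⟩
    intro g v hv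
    have := hφ (g * h) _ hv
    simpa [mul_assoc] using this⟩

/-- A topological group is amenable if there is a mean on `LUCB G` (a positive linear functional
of norm one taking the value `1` at the constant function `1`) that is invariant under all right
translations. The norm of `m` is `1` exactly when `|m φ| ≤ ‖φ‖` for all `φ`, as `m 1 = 1`. -/
def IsAmenable (G : Type*) [Group G] [TopologicalSpace G] [IsTopologicalGroup G] : Prop :=
  ∃ m : LUCB G →ₗ[ℝ] ℝ, (∀ φ : LUCB G, |m φ| ≤ ‖(φ : G →ᵇ ℝ)‖) ∧ m (LUCB.one G) = 1 ∧
    (∀ φ : LUCB G, (∀ x : G, 0 ≤ (φ : G →ᵇ ℝ) x) → 0 ≤ m φ) ∧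
    ∀ (g : G) (φ : LUCB G), m (LUCB.rho g φ) = m φ

/-- `η` is a coupling of `μ` and `ν`: a probability measure on the square with these marginals. -/
structure IsCoupling {X : Type*} [MeasurableSpace X] (μ ν : Measure X)
    (η : Measure (X × X)) : Prop where
  isProbabilityMeasure : IsProbabilityMeasure η
  map_fst : η.map Prod.fst = μ
  map_snd : η.map Prod.snd = ν

/-- The Wasserstein distance of two probability measures on a metric space: the infimum of the
transport cost `∫ d(x,y) dη(x,y)` over all couplings `η`, as an extended nonnegative number. -/
noncomputable def wasserstein {X : Type*} [MetricSpace X] [MeasurableSpace X]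
    (μ ν : Measure X) : ℝ≥0∞ :=
  ⨅ (η : Measure (X × X)) (_ : IsCoupling μ ν η), ∫⁻ p, edist p.1 p.2 ∂η

/-- `f` belongs to `L¹_{d,+,1}(G)` with respect to the Haar measure `μ`: it is a probability
density with finite first moment `∫ d(x,1) f(x) dx`. -/
structure IsMomentDensity {G : Type*} [Group G] [MetricSpace G] [MeasurableSpace G]
    (μ : Measure G) (f : G → ℝ) : Prop where
  nonneg : ∀ x, 0 ≤ f x
  integrable : Integrable f μ
  integral_eq_one : ∫ x, f x ∂μ = 1
  integrable_dist_mul : Integrable (fun x => dist x 1 * f x) μ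

/-- The measure `f dx` with density `f` with respect to `μ`. -/
noncomputable def densityMeasure {G : Type*} [MeasurableSpace G] (μ : Measure G)
    (f : G → ℝ) : Measure G :=
  μ.withDensity (fun x => ENNReal.ofReal (f x))

/-- The Wasserstein distance of two densities `f` and `h` is that of `f dx` and `h dx`. -/
noncomputable def densityWasserstein {G : Type*} [MetricSpace G] [MeasurableSpace G]
    (μ : Measure G) (f h : G → ℝ) : ℝ≥0∞ :=
  wasserstein (densityMeasure μ f) (densityMeasure μ h)

/-- The right translate `R_y f = f(· y)`. -/
def rightTranslate {G : Type*} [Group G] (y : G) (f : G → ℝ) : G → ℝ := fun x => f (x * y)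

/-! Fix finitely many pairs `(s i, t i)`. If no finitely supported probability measure has right
translates by `s i` and `t i` within transport cost `ε` for every `i`, linear programming duality on
each finite set gives 1-Lipschitz `φ i` with `∑ i, (φ i (x * s i) - φ i (x * t i)) ≥ ε / 2` there,
and compactness makes this hold for all `x`. But `x ↦ φ (x * g) - φ x` is bounded and left-uniformly
continuous by left invariance of the metric. Its invariant mean is a continuous homomorphism in `g`,
hence zero, so averaging gives `0 ≥ ε / 2` (`not_forall_le_sum_lipschitz_sub`).

The pairs are then taken from a finite net of `C⁻¹`, and the atoms are smoothed by a density
supported near `1`. The group is unimodular, since the logarithm of its modular character is a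
homomorphism to `ℝ`; hence right translates of densities remain densities. -/

/-! ### Unimodularity -/

/-- The modular character of a locally compact group is continuous. -/
theorem continuous_modularCharacterFun {G : Type*} [Group G] [TopologicalSpace G]
    [IsTopologicalGroup G] [LocallyCompactSpace G] :
    Continuous (Measure.modularCharacterFun : G → NNReal) := by
  borelize G
  let ν : Measure G := Measure.haar
  obtain ⟨⟨f, f_cont⟩, f_comp, f_nonneg, f_one⟩ :
    ∃ f : C(G, ℝ), HasCompactSupport f ∧ 0 ≤ f ∧ f 1 ≠ 0 := exists_continuous_nonneg_pos 1
  have hne : ∫ x, f x ∂ν ≠ 0 :=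
    ne_of_gt (f_cont.integral_pos_of_hasCompactSupport_nonneg_nonzero f_comp f_nonneg f_one)
  rw [NNReal.isEmbedding_coe.continuous_iff]
  -- Passing to `ν.inv` puts the integrand in the form `f (x⁻¹ * g)`, whose integral is continuous
  -- in `g`.
  have key : (NNReal.toReal ∘ (Measure.modularCharacterFun : G → NNReal)) =
      fun g => (∫ x, f (x⁻¹ * g) ∂ν.inv) / ∫ x, f x ∂ν := by
    ext g
    rw [Function.comp_apply, Measure.modularCharacterFun_eq_haarScalarFactor ν g,
      Measure.haarScalarFactor_eq_integral_div _ _ f_cont f_comp hne,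
      integral_map (AEMeasurable.mul_const aemeasurable_id' _)
        (Continuous.aestronglyMeasurable f_cont)]
    congr 1
    refine Eq.trans ?_
      (integral_map_equiv (μ := ν) (MeasurableEquiv.inv G) fun x => f (x⁻¹ * g)).symm
    simp
  rw [key]
  exact (continuous_integral_apply_inv_mul f_cont f_comp).div_const _

/-- A locally compact group without nontrivial continuous homomorphisms to `ℝ` is unimodular. -/
theorem isMulRightInvariant_of_trivial_hom {G : Type*} [Group G] [TopologicalSpace G]
    [IsTopologicalGroup G] [LocallyCompactSpace G] [MeasurableSpace G] [BorelSpace G]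
    (μ : Measure G) [μ.IsHaarMeasure] [μ.InnerRegular]
    (hHom : ∀ χ : G →* Multiplicative ℝ, Continuous χ → χ = 1) : μ.IsMulRightInvariant := by
  have hpos (g : G) : ((Measure.modularCharacterFun g : NNReal) : ℝ) ≠ 0 :=
    NNReal.coe_ne_zero.2 (Measure.modularCharacterFun_pos g).ne'
  let χ : G →* Multiplicative ℝ :=
    { toFun := fun g => Multiplicative.ofAdd (Real.log (Measure.modularCharacterFun g))
      map_one' := by simp [Measure.modularCharacterFun_map_one]
      map_mul' := fun g h => by
        rw [Measure.modularCharacterFun_map_mul, NNReal.coe_mul, Real.log_mul (hpos g) (hpos h),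
          ofAdd_add] }
  have hχ : Continuous χ := continuous_ofAdd.comp
    ((NNReal.continuous_coe.comp continuous_modularCharacterFun).log hpos)
  refine ⟨fun g => ?_⟩
  have h0 : Real.log (Measure.modularCharacterFun g) = 0 :=
    congrArg Multiplicative.toAdd (DFunLike.congr_fun (hHom χ hχ) g)
  have h1 : Measure.modularCharacterFun g = 1 := by
    have := Real.eq_one_of_pos_of_log_eq_zero
      (NNReal.coe_pos.2 (Measure.modularCharacterFun_pos g)) h0
    exact_mod_cast this
  rw [Measure.map_right_mul_eq_modularCharacterFun_smul, h1, one_smul]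

/-! ### Invariant means of Lipschitz differences -/

section Mean

variable {G : Type*} [Group G] [MetricSpace G] [IsTopologicalGroup G]

theorem abs_sub_le_dist_of_lipschitzWith_one {X : Type*} [PseudoMetricSpace X] {φ : X → ℝ}
    (hφ : LipschitzWith 1 φ) (x y : X) : |φ x - φ y| ≤ dist x y := by
  simpa [Real.dist_eq] using hφ.dist_le_mul x y

omit [IsTopologicalGroup G] in
theorem dist_mul_left_self_of_invariant (hd : ∀ g x y : G, dist (g * x) (g * y) = dist x y) (x g : G) :
    dist (x * g) x = dist g 1 := by
  simpa using hd x g 1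

/-- The bounded left-uniformly continuous function `x ↦ φ (x * g) - φ x` attached to a
`1`-Lipschitz function `φ`. -/
noncomputable def lipschitzDiff (hd : ∀ g x y : G, dist (g * x) (g * y) = dist x y) (φ : G → ℝ)
    (hφ : LipschitzWith 1 φ) (g : G) : LUCB G :=
  ⟨BoundedContinuousFunction.ofNormedAddCommGroup (fun x => φ (x * g) - φ x)
      ((hφ.continuous.comp (continuous_mul_const g)).sub hφ.continuous) (dist g 1)
      (fun x => (abs_sub_le_dist_of_lipschitzWith_one hφ _ _).trans
        (dist_mul_left_self_of_invariant hd x g).le), by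
    intro ε hε
    -- By left invariance, moving `x` to `x * v` changes the difference by at most this function of
    -- `v`, uniformly in `x`.
    have hc : Continuous fun v : G => dist (v * g) g + dist v 1 := by fun_prop
    have hV : {v : G | dist (v * g) g + dist v 1 < ε} ∈ 𝓝 (1 : G) :=
      hc.continuousAt.eventually_lt continuousAt_const (by simpa using hε)
    refine ⟨_, hV, fun x v hv => ?_⟩
    have h1 := abs_sub_le_dist_of_lipschitzWith_one hφ (x * v * g) (x * g)
    rw [mul_assoc, hd] at h1
    have h2 := abs_sub_le_dist_of_lipschitzWith_one hφ (x * v) x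
    rw [dist_mul_left_self_of_invariant hd] at h2
    have hv' : dist (v * g) g + dist v 1 < ε := hv
    simp only [BoundedContinuousFunction.coe_ofNormedAddCommGroup]
    rw [mul_assoc]
    rw [abs_le] at h1 h2
    rw [abs_lt]
    constructor <;> linarith⟩

theorem lipschitzDiff_apply (hd : ∀ g x y : G, dist (g * x) (g * y) = dist x y) (φ : G → ℝ)
    (hφ : LipschitzWith 1 φ) (g x : G) :
    (lipschitzDiff hd φ hφ g : G →ᵇ ℝ) x = φ (x * g) - φ x := rfl

theorem norm_lipschitzDiff_le (hd : ∀ g x y : G, dist (g * x) (g * y) = dist x y) (φ : G → ℝ)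
    (hφ : LipschitzWith 1 φ) (g : G) : ‖(lipschitzDiff hd φ hφ g : G →ᵇ ℝ)‖ ≤ dist g 1 :=
  (BoundedContinuousFunction.norm_le dist_nonneg).2 fun x =>
    (abs_sub_le_dist_of_lipschitzWith_one hφ _ _).trans (dist_mul_left_self_of_invariant hd x g).le

/-- A cocycle identity: an invariant mean turns it into additivity in `g`. -/
theorem lipschitzDiff_mul (hd : ∀ g x y : G, dist (g * x) (g * y) = dist x y) (φ : G → ℝ)
    (hφ : LipschitzWith 1 φ) (g h : G) :
    lipschitzDiff hd φ hφ (g * h) =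
      LUCB.rho g (lipschitzDiff hd φ hφ h) + lipschitzDiff hd φ hφ g := by
  apply Subtype.ext
  ext x
  change φ (x * (g * h)) - φ x = (φ (x * g * h) - φ (x * g)) + (φ (x * g) - φ x)
  rw [mul_assoc]; ring

/-- A right invariant mean vanishes on the differences `x ↦ φ (x * g) - φ x` of Lipschitz functions
when the group has no nontrivial continuous homomorphism to `ℝ`. -/
theorem mean_lipschitzDiff_eq_zero (hd : ∀ g x y : G, dist (g * x) (g * y) = dist x y)
    (hHom : ∀ χ : G →* Multiplicative ℝ, Continuous χ → χ = 1)
    (m : LUCB G →ₗ[ℝ] ℝ) (hm : ∀ φ : LUCB G, |m φ| ≤ ‖(φ : G →ᵇ ℝ)‖)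
    (hinv : ∀ (g : G) (φ : LUCB G), m (LUCB.rho g φ) = m φ) (φ : G → ℝ)
    (hφ : LipschitzWith 1 φ) (g : G) : m (lipschitzDiff hd φ hφ g) = 0 := by
  have hmul (g h : G) : m (lipschitzDiff hd φ hφ (g * h)) =
      m (lipschitzDiff hd φ hφ g) + m (lipschitzDiff hd φ hφ h) := by
    rw [lipschitzDiff_mul, map_add, hinv, add_comm]
  let χ : G →* Multiplicative ℝ :=
    MonoidHom.mk' (fun g => Multiplicative.ofAdd (m (lipschitzDiff hd φ hφ g)))
      (fun g h => by rw [hmul, ofAdd_add])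
  have hχ : Continuous χ := by
    apply continuous_of_continuousAt_one χ
    have h0 : m (lipschitzDiff hd φ hφ 1) = 0 := by simpa using hmul 1 1
    have : ContinuousAt (fun g => m (lipschitzDiff hd φ hφ g)) 1 := by
      rw [ContinuousAt, h0]
      refine squeeze_zero_norm (a := fun g : G => dist g 1)
        (fun g => (hm _).trans (norm_lipschitzDiff_le hd φ hφ g)) ?_
      have hc : Continuous fun g : G => dist g 1 := by fun_prop
      simpa using hc.tendsto 1
    exact continuous_ofAdd.continuousAt.comp this
  exact congrArg Multiplicative.toAdd (DFunLike.congr_fun (hHom χ hχ) g)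

/-- In an amenable group without nontrivial continuous homomorphisms to `ℝ`, no sum of differences
of right translates of Lipschitz functions is bounded below by a positive constant. -/
theorem not_forall_le_sum_lipschitz_sub (hd : ∀ g x y : G, dist (g * x) (g * y) = dist x y)
    (hG : IsAmenable G) (hHom : ∀ χ : G →* Multiplicative ℝ, Continuous χ → χ = 1)
    {ι : Type*} [Fintype ι] (s t : ι → G) (φ : ι → G → ℝ) (hφ : ∀ i, LipschitzWith 1 (φ i))
    {c : ℝ} (hc : 0 < c) : ¬ ∀ x : G, c ≤ ∑ i, (φ i (x * s i) - φ i (x * t i)) := by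
  intro h
  obtain ⟨m, hm, hone, hpos, hinv⟩ := hG
  have hsub (a b : LUCB G) : m (a - b) = m a - m b := m.map_sub a b
  -- The `φ i` may be unbounded, so both translates are compared with `φ i` itself; the extra terms
  -- cancel.
  let ψ : LUCB G := ∑ i, (lipschitzDiff hd (φ i) (hφ i) (s i) - lipschitzDiff hd (φ i) (hφ i) (t i))
  have hψ : m ψ = 0 := by
    simp only [ψ, map_sum, hsub, mean_lipschitzDiff_eq_zero hd hHom m hm hinv, sub_self,
      Finset.sum_const_zero]
  have hval (x : G) : (ψ : G →ᵇ ℝ) x = ∑ i, (φ i (x * s i) - φ i (x * t i)) := by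
    simp [ψ, lipschitzDiff_apply]
  have := hpos (ψ - c • LUCB.one G) fun x => by
    have h1 : ((ψ - c • LUCB.one G : LUCB G) : G →ᵇ ℝ) x = (ψ : G →ᵇ ℝ) x - c * 1 := rfl
    rw [h1, hval]
    linarith [h x]
  rw [hsub, map_smul, hone, hψ, smul_eq_mul] at this
  linarith

end Mean

/-! ### Finite duality and Lipschitz certificates -/

/-- Duality for a finite linear program: if some convex combination of the vectors `v z` vanishes,
then either such a combination has cost less than `ε`, or there is a dual certificate. -/
theorem exists_weight_or_dual {Z κ : Type*} [Fintype Z] [Fintype κ] (v : Z → κ → ℝ) (c : Z → ℝ)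
    {ε : ℝ} (hε : 0 < ε) (z₀ : Z) (hz₀ : v z₀ = 0) :
    (∃ W ∈ stdSimplex ℝ Z, (∀ k, ∑ z, W z * v z k = 0) ∧ ∑ z, W z * c z < ε) ∨
      ∃ l : κ → ℝ, ∀ z, ε / 2 ≤ ∑ k, l k * v z k + c z := by
  classical
  by_cases hW : ∃ W ∈ stdSimplex ℝ Z, (∀ k, ∑ z, W z * v z k = 0) ∧ ∑ z, W z * c z < ε
  · exact Or.inl hW
  right
  push Not at hW
  let Φ : (Z → ℝ) →ₗ[ℝ] (κ → ℝ) × ℝ := ∑ z, (LinearMap.proj z).smulRight (v z, c z)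
  have hΦ (W : Z → ℝ) : Φ W = (fun k => ∑ z, W z * v z k, ∑ z, W z * c z) := by
    refine Prod.ext (funext fun k => ?_) ?_ <;>
      simp [Φ, LinearMap.sum_apply, Prod.fst_sum, Prod.snd_sum]
  -- Stopping the ray at `ε / 2` leaves room below the minimal cost `ε`.
  have hdisj : Disjoint (({0} : Set (κ → ℝ)) ×ˢ Set.Iic (ε / 2)) (Φ '' stdSimplex ℝ Z) := by
    rw [Set.disjoint_left]
    rintro p ⟨hp1, hp2⟩ ⟨W, hWs, rfl⟩
    rw [hΦ] at hp1 hp2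
    have := hW W hWs fun k => congrFun (Set.mem_singleton_iff.1 hp1) k
    simp only [Set.mem_Iic] at hp2
    linarith
  obtain ⟨L, u, w, h1, h2, h3⟩ := geometric_hahn_banach_closed_compact
    ((convex_singleton _).prod (convex_Iic _)) (isClosed_singleton.prod isClosed_Iic)
    ((convex_stdSimplex ℝ Z).linear_image Φ)
    ((isCompact_stdSimplex ℝ Z).image Φ.continuous_of_finiteDimensional) hdisj
  have hL (p : κ → ℝ) (r : ℝ) :
      L (p, r) = ∑ k, p k * L (Pi.single k 1, 0) + r * L (0, 1) := by
    have : ((p, r) : (κ → ℝ) × ℝ) =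
        ∑ k, p k • ((Pi.single k 1, 0) : (κ → ℝ) × ℝ) + r • ((0, 1) : (κ → ℝ) × ℝ) := by
      refine Prod.ext (funext fun k => ?_) ?_ <;>
        simp [Prod.fst_sum, Prod.snd_sum, Finset.sum_apply, Pi.single_apply]
    rw [this, map_add, map_sum, map_smul, smul_eq_mul]
    simp_rw [map_smul, smul_eq_mul]
  have hz (z : Z) : w < ∑ k, v z k * L (Pi.single k 1, 0) + c z * L (0, 1) := by
    rw [← hL]
    have := h3 _ ⟨_, single_mem_stdSimplex ℝ z, rfl⟩
    rw [hΦ] at this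
    simpa [Pi.single_apply] using this
  have ht (t : ℝ) (ht : t ≤ ε / 2) : t * L (0, 1) < u := by
    have := h1 (0, t) ⟨rfl, ht⟩
    rw [hL] at this
    simpa using this
  have hc0 : ε ≤ c z₀ := by
    have := hW _ (single_mem_stdSimplex ℝ z₀) (by simp [Pi.single_apply, hz₀])
    simpa [Pi.single_apply] using this
  -- The feasible point `z₀` costs at least `ε`, so it lies strictly above the ray; this rules out a
  -- vertical or downward separating functional.
  have hpos : 0 < L (0, 1) := by
    have := hz z₀
    simp only [hz₀, Pi.zero_apply, zero_mul, Finset.sum_const_zero, zero_add] at this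
    have h4 := ht (ε / 2) le_rfl
    nlinarith
  refine ⟨fun k => L (Pi.single k 1, 0) / L (0, 1), fun z => ?_⟩
  have h4 := hz z
  have h5 := ht (ε / 2) le_rfl
  have h6 : ∑ k, L (Pi.single k 1, 0) / L (0, 1) * v z k =
      (∑ k, v z k * L (Pi.single k 1, 0)) / L (0, 1) := by
    rw [Finset.sum_div]
    exact Finset.sum_congr rfl fun k _ => by ring
  rw [h6]
  have h7 : (∑ k, v z k * L (Pi.single k 1, 0)) / L (0, 1) + c z =
      (∑ k, v z k * L (Pi.single k 1, 0) + c z * L (0, 1)) / L (0, 1) := by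
    field_simp
  rw [h7, le_div_iff₀ hpos]
  linarith

/-- The regularisation `z ↦ min_b (g b + d(z, p b))` of a function on a finite set. -/
noncomputable def lipschitzRegularization {G X : Type*} [MetricSpace G] [Fintype X] [Nonempty X]
    (p : X → G) (g : X → ℝ) (z : G) : ℝ :=
  Finset.univ.inf' Finset.univ_nonempty fun b => g b + dist z (p b)

theorem lipschitzWith_lipschitzRegularization {G X : Type*} [MetricSpace G] [Fintype X]
    [Nonempty X] (p : X → G) (g : X → ℝ) : LipschitzWith 1 (lipschitzRegularization p g) := by
  refine LipschitzWith.of_le_add fun y z => ?_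
  obtain ⟨b, -, hb⟩ := Finset.exists_mem_eq_inf' Finset.univ_nonempty
    fun b => g b + dist z (p b)
  rw [lipschitzRegularization, lipschitzRegularization, hb]
  refine (Finset.inf'_le _ (Finset.mem_univ b)).trans ?_
  linarith [dist_triangle y z (p b)]

theorem lipschitzRegularization_le {G X : Type*} [MetricSpace G] [Fintype X] [Nonempty X]
    (p : X → G) (g : X → ℝ) (b : X) : lipschitzRegularization p g (p b) ≤ g b :=
  (Finset.inf'_le _ (Finset.mem_univ b)).trans (by simp)

/-- A dual certificate for the transport problem between right translates of a measure on a finite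
set can be chosen to consist of Lipschitz functions. -/
theorem exists_lipschitz_of_dual {G X ι : Type*} [Group G] [MetricSpace G] [Fintype X] [Nonempty X]
    [Fintype ι] (s t : ι → G) (q : X → G) {r : ℝ} (g : ι → X → ℝ)
    (h : ∀ (x : X) (b : ι → X), r ≤ ∑ i, (g i (b i) - g i x + dist (q x * s i) (q (b i) * t i))) :
    ∃ φ : ι → G → ℝ, (∀ i, LipschitzWith 1 (φ i)) ∧
      ∀ x, r ≤ ∑ i, (φ i (q x * s i) - φ i (q x * t i)) := by
  refine ⟨fun i => lipschitzRegularization (fun b => q b * t i) (g i),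
    fun i => lipschitzWith_lipschitzRegularization _ _, fun x => ?_⟩
  have hb (i : ι) (z : G) : ∃ b, lipschitzRegularization (fun b => q b * t i) (g i) z =
      g i b + dist z (q b * t i) := by
    obtain ⟨b, -, hb⟩ := Finset.exists_mem_eq_inf' Finset.univ_nonempty
      fun b => g i b + dist z (q b * t i)
    exact ⟨b, hb⟩
  -- The certificate holds for all tuples `b`, so the minimiser can be picked separately for each
  -- `i`.
  choose B hB using fun i => hb i (q x * s i)
  refine (h x B).trans (Finset.sum_le_sum fun i _ => ?_)
  have := lipschitzRegularization_le (fun b => q b * t i) (g i) x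
  beta_reduce at this ⊢
  rw [hB]
  linarith

/-- If no finitely supported measure on `S` has nearby right translates by `s i` and `t i`, then this
is witnessed by Lipschitz functions. -/
theorem exists_weight_or_lipschitz {G ι : Type*} [Group G] [MetricSpace G] [Fintype ι]
    [DecidableEq ι]
    (s t : ι → G) {ε : ℝ} (hε : 0 < ε) (S : Finset G) [Nonempty S] :
    (∃ W ∈ stdSimplex ℝ (S × (ι → S)),
      (∀ i (F : G → ℝ), ∑ z, W z * F (z.2 i) = ∑ z, W z * F z.1) ∧
      ∑ z, W z * ∑ i, dist ((z.1 : G) * s i) (z.2 i * t i) < ε) ∨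
    ∃ φ : ι → G → ℝ, (∀ i, LipschitzWith 1 (φ i)) ∧
      ∀ x ∈ S, ε / 2 ≤ ∑ i, (φ i (x * s i) - φ i (x * t i)) := by
  classical
  let x₀ : S := Classical.arbitrary S
  -- A point `(x, b)` lets the `i`-th plan pair `x` with `b i`, all plans sharing `x`. Constraint
  -- `(i, y)` gives `b i` and `x` equal mass at `y`; the constant tuple at `x₀` is feasible.
  rcases exists_weight_or_dual (Z := S × (ι → S)) (κ := ι × S)
    (fun z k => (if z.2 k.1 = k.2 then 1 else 0) - (if z.1 = k.2 then 1 else 0))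
    (fun z => ∑ i, dist ((z.1 : G) * s i) (z.2 i * t i)) hε (x₀, fun _ => x₀)
    (by ext k; simp) with ⟨W, hW, h1, h2⟩ | ⟨l, hl⟩
  · refine Or.inl ⟨W, hW, fun i F => ?_, h2⟩
    have h3 (y : S) : ∑ z, W z * (if z.2 i = y then 1 else 0) =
        ∑ z, W z * (if z.1 = y then (1 : ℝ) else 0) := by
      have := h1 (i, y)
      simp only [mul_sub, Finset.sum_sub_distrib] at this
      exact sub_eq_zero.1 this
    have h4 (p : S × (ι → S) → S) : ∑ z, W z * F (p z) =
        ∑ y : S, (∑ z, W z * (if p z = y then (1 : ℝ) else 0)) * F y := by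
      simp_rw [Finset.sum_mul]
      rw [Finset.sum_comm]
      simp
    rw [h4 fun z => z.2 i, h4 fun z => z.1]
    simp_rw [h3]
  · right
    obtain ⟨φ, hφ, h⟩ := exists_lipschitz_of_dual s t (fun x : S => (x : G)) (r := ε / 2)
      (fun i x => l (i, x)) (fun x b => by
        have := hl (x, b)
        simpa [Fintype.sum_prod_type, mul_sub, Finset.sum_sub_distrib, Finset.sum_add_distrib]
          using this)
    exact ⟨φ, hφ, fun x hx => h ⟨x, hx⟩⟩

/-! ### From finite sets to the whole group -/

/-- A compactness argument: if the Lipschitz functions exist for every finite set, then they exist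
globally. -/
theorem exists_lipschitz_of_forall_finset {G ι : Type*} [Group G] [MetricSpace G] [Fintype ι]
    (s t : ι → G) {r : ℝ}
    (h : ∀ S : Finset G, ∃ φ : ι → G → ℝ, (∀ i, LipschitzWith 1 (φ i)) ∧
      ∀ x ∈ S, r ≤ ∑ i, (φ i (x * s i) - φ i (x * t i))) :
    ∃ φ : ι → G → ℝ, (∀ i, LipschitzWith 1 (φ i)) ∧
      ∀ x, r ≤ ∑ i, (φ i (x * s i) - φ i (x * t i)) := by
  classical
  -- Subtracting `φ i 1` changes no difference and puts every 1-Lipschitz function in this box,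
  -- compact by Tychonoff.
  let K : Set (ι → G → ℝ) := Set.univ.pi fun _ => Set.univ.pi fun x => Set.Icc (-dist x 1) (dist x 1)
  have hK : IsCompact K := isCompact_univ_pi fun _ => isCompact_univ_pi fun _ => isCompact_Icc
  let A (S : Finset G) : Set (ι → G → ℝ) :=
    {φ : ι → G → ℝ | (∀ i x y, φ i x ≤ φ i y + dist x y) ∧
      ∀ x ∈ S, r ≤ ∑ i, (φ i (x * s i) - φ i (x * t i))}
  have hA (S : Finset G) : IsClosed (A S) := by
    refine IsClosed.inter (s₁ := {φ : ι → G → ℝ | ∀ i x y, φ i x ≤ φ i y + dist x y})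
      (s₂ := {φ : ι → G → ℝ | ∀ x ∈ S, r ≤ ∑ i, (φ i (x * s i) - φ i (x * t i))}) ?_ ?_
    · simp only [Set.ofPred_forall]
      exact isClosed_iInter fun i => isClosed_iInter fun x => isClosed_iInter fun y =>
        isClosed_le (by fun_prop) (by fun_prop)
    · simp only [Set.ofPred_forall]
      exact isClosed_iInter fun x => isClosed_iInter fun _ =>
        isClosed_le (by fun_prop) (by fun_prop)
  have hne (S : Finset G) : (A S ∩ K).Nonempty := by
    obtain ⟨φ, hφ, hS⟩ := h S
    refine ⟨fun i x => φ i x - φ i 1, ⟨fun i x y => ?_, fun x hx => ?_⟩, fun i _ x _ => ?_⟩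
    · have := (hφ i).le_add_mul x y
      simp only [NNReal.coe_one, one_mul] at this
      linarith
    · simpa using hS x hx
    · have h1 := (hφ i).le_add_mul x 1
      have h2 := (hφ i).le_add_mul 1 x
      simp only [NNReal.coe_one, one_mul] at h1 h2
      rw [dist_comm] at h2
      constructor <;> linarith
  have hdir : Directed (· ⊇ ·) fun S => A S ∩ K := by
    refine directed_of_isDirected_le fun S T hST φ hφ => ⟨⟨hφ.1.1, fun x hx => ?_⟩, hφ.2⟩
    exact hφ.1.2 x (hST hx)
  obtain ⟨φ, hφ⟩ := IsCompact.nonempty_iInter_of_directed_nonempty_isCompact_isClosed _ hdir hne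
    (fun S => hK.inter_left (hA S)) (fun S => (hA S).inter hK.isClosed)
  rw [Set.mem_iInter] at hφ
  exact ⟨φ, fun i => LipschitzWith.of_le_add fun x y => (hφ ∅).1.1 i x y,
    fun x => (hφ {x}).1.2 x (Finset.mem_singleton_self x)⟩

/-! ### Smoothing finitely supported measures -/

section Smoothing

variable {G : Type*} [Group G] [MetricSpace G] [IsTopologicalGroup G] [MeasurableSpace G]
  [BorelSpace G]

omit [IsTopologicalGroup G] in
/-- A compactly supported probability density has a finite first moment. -/
theorem isMomentDensity_of_hasCompactSupport (μ : Measure G) {f : G → ℝ} (hf : ∀ x, 0 ≤ f x)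
    (hint : Integrable f μ) (hone : ∫ x, f x ∂μ = 1) (hsupp : HasCompactSupport f) :
    IsMomentDensity μ f := by
  refine ⟨hf, hint, hone, ?_⟩
  have hc : Continuous fun x : G => dist x 1 := by fun_prop
  have h1 : IntegrableOn (fun x => dist x 1 * f x) (tsupport f) μ :=
    hint.integrableOn.continuousOn_mul hc.continuousOn hsupp
  rw [integrableOn_iff_integrable_of_support_subset] at h1
  · exact h1
  · intro x hx
    exact subset_tsupport f (right_ne_zero_of_mul hx)

theorem isMomentDensity_rightTranslate (μ : Measure G) [μ.IsMulRightInvariant] {f : G → ℝ}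
    (hf : IsMomentDensity μ f) (hsupp : HasCompactSupport f) (y : G) :
    IsMomentDensity μ (rightTranslate y f) :=
  isMomentDensity_of_hasCompactSupport μ (fun _ => hf.nonneg _) (hf.integrable.comp_mul_right y)
    ((integral_mul_right_eq_self f y).trans hf.integral_eq_one)
    (hsupp.comp_homeomorph (Homeomorph.mulRight y))

/-- On a unimodular group, translating a density on both sides translates the measure. -/
theorem densityMeasure_translate (μ : Measure G) [μ.IsMulLeftInvariant] [μ.IsMulRightInvariant]
    {u : G → ℝ} (hu : Measurable u) (x y : G) :
    densityMeasure μ (fun z => u (x⁻¹ * z * y)) =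
      (densityMeasure μ u).map (fun s => x * s * y⁻¹) := by
  have hT : MeasurePreserving (fun s : G => x * s * y⁻¹) μ μ :=
    (measurePreserving_mul_right μ y⁻¹).comp (measurePreserving_mul_left μ x)
  have hg : Measurable fun z : G => ENNReal.ofReal (u (x⁻¹ * z * y)) := by fun_prop
  ext B hB
  rw [Measure.map_apply hT.measurable hB, densityMeasure, densityMeasure, withDensity_apply _ hB,
    withDensity_apply _ (hT.measurable hB), ← hT.setLIntegral_comp_preimage hB hg]
  simp [mul_assoc]

omit [Group G] [IsTopologicalGroup G] [BorelSpace G] [MetricSpace G] in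
theorem densityMeasure_sum (μ : Measure G) {Z : Type*} [Fintype Z] {W : Z → ℝ} (hW : ∀ z, 0 ≤ W z)
    {u : Z → G → ℝ} (hu : ∀ z, Measurable (u z)) (hu0 : ∀ z x, 0 ≤ u z x) :
    densityMeasure μ (fun x => ∑ z, W z * u z x) =
      ∑ z, ENNReal.ofReal (W z) • densityMeasure μ (u z) := by
  ext B hB
  rw [densityMeasure, withDensity_apply _ hB, Measure.finsetSum_apply]
  simp_rw [ENNReal.ofReal_sum_of_nonneg fun z (_ : z ∈ Finset.univ) =>
    mul_nonneg (hW z) (hu0 z _), ENNReal.ofReal_mul (hW _)]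
  rw [lintegral_finsetSum _ fun z _ => by have := hu z; fun_prop]
  refine Finset.sum_congr rfl fun z _ => ?_
  rw [lintegral_const_mul _ (by have := hu z; fun_prop), Measure.smul_apply, densityMeasure,
    withDensity_apply _ hB, smul_eq_mul]

omit [Group G] [IsTopologicalGroup G] [BorelSpace G] [MetricSpace G] in
/-- Two weighted finite sums of members of a family of probability measures agree when the weighted
index points have the same law. -/
theorem sum_smul_measure_congr {X Z : Type*} [Fintype Z] {W : Z → ℝ} (hW : ∀ z, 0 ≤ W z)
    {p q : Z → X} (h : ∀ F : X → ℝ, ∑ z, W z * F (p z) = ∑ z, W z * F (q z))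
    (M : X → Measure G) [∀ x, IsProbabilityMeasure (M x)] :
    ∑ z, ENNReal.ofReal (W z) • M (p z) = ∑ z, ENNReal.ofReal (W z) • M (q z) := by
  ext B hB
  have key (r : Z → X) : (∑ z, ENNReal.ofReal (W z) • M (r z)) B =
      ENNReal.ofReal (∑ z, W z * (M (r z)).real B) := by
    rw [Measure.finsetSum_apply, ENNReal.ofReal_sum_of_nonneg fun z _ =>
      mul_nonneg (hW z) measureReal_nonneg]
    refine Finset.sum_congr rfl fun z _ => ?_
    rw [ENNReal.ofReal_mul (hW z), Measure.smul_apply, smul_eq_mul, ofReal_measureReal]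
  rw [key, key, h fun x => (M x).real B]

end Smoothing

/-- Finitely supported probability measures whose right translates by `s i` and `t i` are close in
transport cost. The atoms of the measure are `x z`, and `(x z, b i z)` describes the `i`-th
transport plan. -/
theorem exists_finite_almost_invariant {G : Type*} [Group G] [MetricSpace G] [IsTopologicalGroup G]
    (hd : ∀ g x y : G, dist (g * x) (g * y) = dist x y) (hG : IsAmenable G)
    (hHom : ∀ χ : G →* Multiplicative ℝ, Continuous χ → χ = 1) {ι : Type*} [Fintype ι]
    [DecidableEq ι] (s t : ι → G) {ε : ℝ} (hε : 0 < ε) :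
    ∃ (S : Finset G) (W : S × (ι → S) → ℝ), (∀ z, 0 ≤ W z) ∧ ∑ z, W z = 1 ∧
      (∀ i (F : G → ℝ), ∑ z, W z * F (z.2 i) = ∑ z, W z * F z.1) ∧
      ∀ i, ∑ z, W z * dist ((z.1 : G) * s i) (z.2 i * t i) < ε := by
  by_contra hcon
  push Not at hcon
  obtain ⟨φ, hφ, h⟩ := exists_lipschitz_of_forall_finset s t (r := ε / 2) fun S => by
    rcases S.eq_empty_or_nonempty with rfl | hS
    -- Duality needs a nonempty set; on the empty one the inequality is vacuous.
    · exact ⟨fun _ _ => 0, fun _ => LipschitzWith.const' 0, by simp⟩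
    have : Nonempty S := hS.to_subtype
    rcases exists_weight_or_lipschitz s t hε S with ⟨W, hW, h1, h2⟩ | h
    · exfalso
      obtain ⟨i, hi⟩ := hcon S W hW.1 hW.2 h1
      refine absurd (hi.trans (Finset.sum_le_sum fun z _ => ?_)) (not_le.2 h2)
      exact mul_le_mul_of_nonneg_left (Finset.single_le_sum
        (f := fun i => dist ((z.1 : G) * s i) (z.2 i * t i))
        (fun _ _ => dist_nonneg) (Finset.mem_univ i)) (hW.1 z)
    · exact h
  exact not_forall_le_sum_lipschitz_sub hd hG hHom s t φ hφ (half_pos hε) h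

section Wasserstein

variable {G : Type*} [Group G] [MetricSpace G] [IsTopologicalGroup G] [SecondCountableTopology G]
  [MeasurableSpace G] [BorelSpace G]

/-- The transport plan obtained by smoothing a finite transport plan bounds the Wasserstein
distance. -/
theorem wasserstein_sum_map_le {Z : Type*} [Fintype Z] {W : Z → ℝ} (hW : ∀ z, 0 ≤ W z)
    (hW1 : ∑ z, W z = 1) (κ : Measure G) [IsProbabilityMeasure κ] (a b : Z → G) (g h : G)
    {c : Z → ℝ} (hc : ∀ z, 0 ≤ c z)
    (hcost : ∀ z, ∀ᵐ s ∂κ, dist (a z * s * g) (b z * s * h) ≤ c z) :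
    wasserstein (∑ z, ENNReal.ofReal (W z) • κ.map (fun s => a z * s * g))
      (∑ z, ENNReal.ofReal (W z) • κ.map (fun s => b z * s * h)) ≤
      ENNReal.ofReal (∑ z, W z * c z) := by
  have hm (x y : G) : Measurable fun s : G => x * s * y := by fun_prop
  have hm2 (z : Z) : Measurable fun s : G => (a z * s * g, b z * s * h) :=
    (hm _ _).prodMk (hm _ _)
  -- Both endpoints use the same smoothing variable `s`.
  let η : Measure (G × G) :=
    ∑ z, ENNReal.ofReal (W z) • κ.map (fun s => (a z * s * g, b z * s * h))
  have hmap (p : G × G → G) (hp : Measurable p) : η.map p =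
      ∑ z, ENNReal.ofReal (W z) • κ.map (fun s => p (a z * s * g, b z * s * h)) := by
    ext B hB
    simp only [η, Measure.map_apply hp hB, Measure.finsetSum_apply, Measure.smul_apply]
    refine Finset.sum_congr rfl fun z _ => ?_
    rw [← Measure.map_apply hp hB, Measure.map_map hp (hm2 z)]
    rfl
  have hη : IsCoupling (∑ z, ENNReal.ofReal (W z) • κ.map (fun s => a z * s * g))
      (∑ z, ENNReal.ofReal (W z) • κ.map (fun s => b z * s * h)) η := by
    refine ⟨⟨?_⟩, hmap _ measurable_fst, hmap _ measurable_snd⟩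
    simp only [η, Measure.finsetSum_apply, Measure.smul_apply,
      Measure.map_apply (hm2 _) MeasurableSet.univ, Set.preimage_univ, measure_univ, smul_eq_mul,
      mul_one]
    rw [← ENNReal.ofReal_sum_of_nonneg fun z _ => hW z, hW1, ENNReal.ofReal_one]
  refine (iInf₂_le η hη).trans ?_
  rw [lintegral_finsetSum_measure, ENNReal.ofReal_sum_of_nonneg fun z _ => mul_nonneg (hW z) (hc z)]
  refine Finset.sum_le_sum fun z _ => ?_
  rw [lintegral_smul_measure, ENNReal.ofReal_mul (hW z), smul_eq_mul,
    lintegral_map (by fun_prop) (hm2 z)]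
  gcongr
  calc ∫⁻ s, edist (a z * s * g) (b z * s * h) ∂κ ≤ ∫⁻ _, ENNReal.ofReal (c z) ∂κ := by
        refine lintegral_mono_ae ?_
        filter_upwards [hcost z] with s hs
        rw [edist_dist]
        exact ENNReal.ofReal_le_ofReal hs
    _ = ENNReal.ofReal (c z) := by simp

end Wasserstein

/-! ### Construction of the density -/

/-- Near the identity there are compactly supported probability densities. -/
theorem exists_density_near_one {G : Type*} [Group G] [TopologicalSpace G] [IsTopologicalGroup G]
    [T2Space G] [LocallyCompactSpace G] [MeasurableSpace G] [BorelSpace G] (μ : Measure G)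
    [μ.IsHaarMeasure] {V : Set G} (hV : V ∈ 𝓝 (1 : G)) :
    ∃ (K : Set G) (u : G → ℝ), IsCompact K ∧ K ⊆ V ∧ (∀ x, 0 ≤ u x) ∧ (∀ x ∉ K, u x = 0) ∧
      Measurable u ∧ Integrable u μ ∧ ∫ x, u x ∂μ = 1 := by
  obtain ⟨K, hK1, hKV, hK⟩ := local_compact_nhds hV
  have hpos : 0 < μ.real K :=
    ENNReal.toReal_pos (Measure.measure_pos_of_mem_nhds μ hK1).ne' hK.measure_lt_top.ne
  refine ⟨K, K.indicator fun _ => (μ.real K)⁻¹, hK, hKV,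
    Set.indicator_nonneg fun _ _ => (inv_pos.2 hpos).le, fun x hx => Set.indicator_of_notMem hx _,
    measurable_const.indicator hK.measurableSet,
    (integrable_indicator_iff hK.measurableSet).2
      (integrableOn_const hK.measure_lt_top.ne), ?_⟩
  rw [integral_indicator hK.measurableSet, setIntegral_const, smul_eq_mul,
    mul_inv_cancel₀ hpos.ne']

theorem ae_densityMeasure_mem {G : Type*} [MeasurableSpace G] (μ : Measure G) {u : G → ℝ}
    {K : Set G} (hu : Measurable u) (hK : ∀ x ∉ K, u x = 0) :
    ∀ᵐ s ∂densityMeasure μ u, s ∈ K := by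
  rw [densityMeasure, ae_withDensity_iff (by fun_prop)]
  refine ae_of_all _ fun x hx => ?_
  by_contra h
  exact hx (by simp [hK x h])

theorem isProbabilityMeasure_densityMeasure {G : Type*} [MeasurableSpace G] (μ : Measure G)
    {u : G → ℝ} (hu : ∀ x, 0 ≤ u x) (hint : Integrable u μ) (hone : ∫ x, u x ∂μ = 1) :
    IsProbabilityMeasure (densityMeasure μ u) :=
  ⟨by rw [densityMeasure, withDensity_apply _ MeasurableSet.univ, Measure.restrict_univ,
    ← ofReal_integral_eq_lintegral_ofReal hint (ae_of_all _ hu), hone, ENNReal.ofReal_one]⟩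

theorem mainTheorem2 {G : Type*} [Group G] [MetricSpace G] [IsTopologicalGroup G]
    [LocallyCompactSpace G] [SecondCountableTopology G] [MeasurableSpace G] [BorelSpace G]
    (μ : Measure G) [μ.IsHaarMeasure]
    (hd : ∀ g x y : G, dist (g * x) (g * y) = dist x y)
    (hG : IsAmenable G)
    (hHom : ∀ χ : G →* Multiplicative ℝ, Continuous χ → χ = 1)
    (C : Set G) (hC : IsCompact C) (ε : ℝ) (hε : 0 < ε) :
    ∃ f : G → ℝ, HasCompactSupport f ∧ IsMomentDensity μ f ∧
      (∀ y : G, IsMomentDensity μ (rightTranslate y f)) ∧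
      ∀ y ∈ C, ∀ z ∈ C,
        densityWasserstein μ (rightTranslate y f) (rightTranslate z f) < ENNReal.ofReal ε := by
  classical
  have := isMulRightInvariant_of_trivial_hom μ hHom
  have hδ : 0 < ε / 16 := by positivity
  -- The net is for `C⁻¹` because `R_y` moves mass by `y⁻¹` on the right. Netting and smoothing cost
  -- `ε / 16` each at either end, in all `ε / 4`, on top of a plan costing less than `ε / 2`.
  obtain ⟨F, hF, hCF⟩ := Metric.totallyBounded_iff.1 hC.inv.totallyBounded (ε / 16) hδ
  have hnet (y : G) (hy : y ∈ C) : ∃ p : hF.toFinset, dist y⁻¹ p < ε / 16 := by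
    obtain ⟨p, hp, hyp⟩ := Set.mem_iUnion₂.1 (hCF (Set.inv_mem_inv.2 hy))
    exact ⟨⟨p, hF.mem_toFinset.2 hp⟩, hyp⟩
  obtain ⟨S, W, hW, hW1, hmarg, hcost⟩ := exists_finite_almost_invariant hd hG hHom
    (fun i : hF.toFinset × hF.toFinset => (i.1 : G)) (fun i => (i.2 : G)) (half_pos hε)
  have hV : {s : G | ∀ p : hF.toFinset, dist (s * p) p < ε / 16} ∈ 𝓝 (1 : G) := by
    refine Filter.eventually_all.2 fun p => ?_
    have hc : Continuous fun s : G => dist (s * p) p := by fun_prop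
    exact hc.continuousAt.eventually_lt continuousAt_const (by simpa using hδ)
  obtain ⟨K, u, hK, hKV, hu0, huK, hu, hui, hu1⟩ := exists_density_near_one μ hV
  have hκ := isProbabilityMeasure_densityMeasure μ hu0 hui hu1
  let f : G → ℝ := fun x => ∑ z, W z * u ((z.1 : G)⁻¹ * x)
  have hfsupp : HasCompactSupport f := by
    refine HasCompactSupport.intro (K := ⋃ z : S, (fun x => (z : G) * x) '' K)
      (isCompact_iUnion fun z => hK.image (continuous_const_mul _)) fun x hx => ?_
    refine Finset.sum_eq_zero fun z _ => ?_
    rw [huK, mul_zero]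
    exact fun h => hx (Set.mem_iUnion.2 ⟨z.1, _, h, mul_inv_cancel_left _ _⟩)
  have hui' (g : G) : Integrable (fun x => u (g * x)) μ := hui.comp_mul_left g
  have hf : IsMomentDensity μ f := by
    refine isMomentDensity_of_hasCompactSupport μ
      (fun x => Finset.sum_nonneg fun z _ => mul_nonneg (hW z) (hu0 _))
      (integrable_finsetSum _ fun z _ => (hui' _).const_mul _) ?_ hfsupp
    rw [integral_finsetSum _ fun z _ => (hui' _).const_mul _]
    simp_rw [integral_const_mul, integral_mul_left_eq_self, hu1, mul_one, hW1]
  refine ⟨f, hfsupp, hf, isMomentDensity_rightTranslate μ hf hfsupp, fun y hy z hz => ?_⟩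
  have hmeas (y : G) : densityMeasure μ (rightTranslate y f) =
      ∑ w, ENNReal.ofReal (W w) •
        (densityMeasure μ u).map (fun s => ((w.1 : S) : G) * s * y⁻¹) := by
    have h1 : rightTranslate y f = fun x => ∑ w, W w * u ((w.1 : G)⁻¹ * x * y) := by
      ext x; simp [rightTranslate, f, mul_assoc]
    rw [h1, densityMeasure_sum μ hW (u := fun w x => u ((w.1 : G)⁻¹ * x * y))
      (fun w => by fun_prop) (fun w x => hu0 _)]
    simp_rw [densityMeasure_translate μ hu]
  obtain ⟨p, hp⟩ := hnet y hy
  obtain ⟨q, hq⟩ := hnet z hz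
  have hprob (x : G) :
      IsProbabilityMeasure ((densityMeasure μ u).map (fun s => x * s * z⁻¹)) :=
    Measure.isProbabilityMeasure_map (by fun_prop)
  -- For the target, the atoms `w.1` are replaced by the equally distributed `w.2 (p, q)`, so that
  -- the finite plan pairs the two sums term by term.
  rw [densityWasserstein, hmeas, hmeas, ← sum_smul_measure_congr hW (hmarg (p, q))
    (fun x => (densityMeasure μ u).map (fun s => x * s * z⁻¹))]
  refine (wasserstein_sum_map_le hW hW1 _ _ _ _ _
    (c := fun w => dist ((w.1 : G) * p) (w.2 (p, q) * q) + ε / 4) (fun w => by positivity)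
    fun w => ?_).trans_lt ?_
  · filter_upwards [ae_densityMeasure_mem μ hu huK] with s hs
    have key (x g : G) (r : hF.toFinset) (hr : dist g r < ε / 16) :
        dist (x * s * g) (x * r) ≤ ε / 8 := by
      have h1 : dist (x * s * g) (x * s * r) = dist g r := hd _ _ _
      have h2 : dist (x * s * r) (x * r) = dist (s * r) r := by rw [mul_assoc, hd]
      have h3 : dist (s * r) r < ε / 16 := hKV hs r
      linarith [dist_triangle (x * s * g) (x * s * r) (x * r)]
    have h1 := key w.1 _ p hp
    have h2 := key (w.2 (p, q)) _ q hq
    rw [dist_comm] at h2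
    have h3 := dist_triangle4 ((w.1 : G) * s * y⁻¹) (w.1 * p) (w.2 (p, q) * q)
      (w.2 (p, q) * s * z⁻¹)
    linarith
  · refine (ENNReal.ofReal_lt_ofReal_iff hε).2 ?_
    simp_rw [mul_add, Finset.sum_add_distrib, ← Finset.sum_mul, hW1]
    have := hcost (p, q)
    simp only at this
    linarith
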